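/- Let $X$ be a metric space that is $\delta$-hyperbolic in the sense of Gromov for some $\delta$, geodesic, and a visibility space (any two distinct points of the Gromov boundary $\partial X$ are the endpoints of a bi-infinite geodesic), and let $o\in X$. Let $G$ be a hyperbolic isometry of $X$, i.e. an isometry for which $n\mapsto G^n o$ is a quasi-isometric embedding of $\mathbb Z$ into $X$, and let $G^{+},G^{-}\in\partial X$ be its attracting and repelling points, i.e. the limits of $G^{n}o$ and $G^{-n}o$ as $n\to+\infty$. Let $D_1,D_2$ be (surjective) isometries of $X$ with $D_1(G^-)\neq G^-$ and $D_2(G^+)\neq G^+$. For an integer $N\ge 1$, let $\mathcal H_N$ be the set of reduced bi-infinite words $H=(H_n)_{n\in\mathbb Z}$ (that is, $H_n\ne H_{n+1}^{-1}$ for all $n$) in the six formal letters $G^{\pm1},D_1^{\pm1},D_2^{\pm1}$ that have the form $$\cdots D_1^{\pm1}\,\underbrace{G^{-1}\cdots G^{-1}}_{\ge N}\,D_2^{\pm1}\,\underbrace{G\cdots G}_{\ge N}\,D_1^{\pm1}\,\underbrace{G^{-1}\cdots G^{-1}}_{\ge N}\,D_2^{\pm1}\,\underbrace{G\cdots G}_{\ge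 N}\cdots,$$ where the signs and the block lengths may vary along the word. Explicitly: if $n_1<n_2$, $H_{n_1}$ and $H_{n_2}$ are letters $D_i^{\pm1}$ ($i\in\{1,2\}$) and every letter strictly between them is $G^{\pm 1}$, then $n_2-n_1-1\ge N$ and either $H_{n_1}\in\{D_1^{\pm1}\}$, $H_{n_2}\in\{D_2^{\pm1}\}$ and all the letters strictly between them are $G^{-1}$, or $H_{n_1}\in\{D_2^{\pm1}\}$, $H_{n_2}\in\{D_1^{\pm1}\}$ and all the letters strictly between them are $G$. The word may also contain only finitely many letters $D_i^{\pm1}$, or none; an infinite block of letters $G^{\pm1}$ bounded by a letter $D_i^{\pm1}$ must then have the sign that the displayed form prescribes: all $G^{-1}$ after a last letter $D_1^{\pm1}$ or before a first letter $D_2^{\pm1}$, and all $G$ after a last letter $D_2^{\pm1}$ or before a first letter $D_1^{\pm1}$. For such a word put $W_n=H_0H_1\cdots H_{n-1}$ for $n>0$, $W_0=\mathrm{Id}$, and $W_n=H_{-1}^{-1}\cdots H_{n}^{-1}$ for $n<0$, evaluated as isometries of $X$. Then there are $\lambda>0$, $k\ge 0$ and an integer $N\ge1$ such that for every $H\in\mathcal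 H_N$ the sequence $x_n=W_n o$ is a $(\lambda,k)$-quasi-geodesic: $$\frac1\lambda|n-m|-k\le d(x_n,x_m)\le\lambda|n-m|+k\qquad\text{for all } n,m\in\mathbb Z .$$ -/

import Mathlib

open Filter

/-! ### Gromov-hyperbolic spaces -/

/-- The Gromov product `(x | y)_o`. -/
noncomputable def gromovProduct {X : Type*} [MetricSpace X] (o x y : X) : ℝ :=
  (dist x o + dist y o - dist x y) / 2

/-- `δ`-hyperbolicity in the sense of Gromov (the four-point condition, for all basepoints). -/
def IsDeltaHyperbolic (X : Type*) [MetricSpace X] (δ : ℝ) : Prop :=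
  ∀ o x y z : X,
    min (gromovProduct o x y) (gromovProduct o y z) - δ ≤ gromovProduct o x z

/-- A metric space that is `δ`-hyperbolic for some `δ`. -/
class GromovHyperbolicSpace (X : Type*) [MetricSpace X] : Prop where
  exists_delta : ∃ δ : ℝ, IsDeltaHyperbolic X δ

/-- Any two points are joined by a geodesic segment. -/
def IsGeodesicSpace (X : Type*) [MetricSpace X] : Prop :=
  ∀ x y : X, ∃ γ : ℝ → X, γ 0 = x ∧ γ (dist x y) = y ∧
    ∀ s ∈ Set.Icc 0 (dist x y), ∀ t ∈ Set.Icc 0 (dist x y), dist (γ s) (γ t) = |s - t|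

/-! ### The Gromov boundary -/

/-- A sequence converges at infinity if `(u i | u j)_o → ∞` as `i, j → ∞`
(for one, equivalently for every, basepoint `o`). -/
def ConvergesAtInfinity {X : Type*} [MetricSpace X] (u : ℕ → X) : Prop :=
  ∀ o : X, Tendsto (fun p : ℕ × ℕ => gromovProduct o (u p.1) (u p.2)) atTop atTop

theorem gromovProduct_comm {X : Type*} [MetricSpace X] (o x y : X) :
    gromovProduct o x y = gromovProduct o y x := by
  unfold gromovProduct
  rw [dist_comm x y]
  ring

/-- Two sequences converging at infinity are equivalent if `(u i | v j)_o → ∞`. -/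
def boundarySetoid (X : Type*) [MetricSpace X] [GromovHyperbolicSpace X] :
    Setoid {u : ℕ → X // ConvergesAtInfinity u} where
  r u v := ∀ o : X, Tendsto (fun p : ℕ × ℕ => gromovProduct o (u.1 p.1) (v.1 p.2)) atTop atTop
  iseqv :=
    { refl := fun u => u.2
      symm := by
        intro u v h o
        have hswap : Tendsto (fun p : ℕ × ℕ => (p.2, p.1)) atTop atTop := by
          rw [← prod_atTop_atTop_eq]
          exact tendsto_snd.prodMk tendsto_fst
        refine ((h o).comp hswap).congr ?_
        intro p
        exact gromovProduct_comm _ _ _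
      trans := by
        intro u v w huv hvw o
        obtain ⟨δ, hδ⟩ := GromovHyperbolicSpace.exists_delta (X := X)
        have hfst : Tendsto (fun p : ℕ × ℕ => p.1) atTop atTop := by
          rw [← prod_atTop_atTop_eq]
          exact tendsto_fst
        have hsnd : Tendsto (fun p : ℕ × ℕ => p.2) atTop atTop := by
          rw [← prod_atTop_atTop_eq]
          exact tendsto_snd
        have h1 : Tendsto (fun p : ℕ × ℕ => (p.1, p.1)) atTop atTop := by
          rw [← prod_atTop_atTop_eq (α := ℕ) (β := ℕ)]
          exact (prod_atTop_atTop_eq (α := ℕ) (β := ℕ) ▸ hfst).prodMk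
            (prod_atTop_atTop_eq (α := ℕ) (β := ℕ) ▸ hfst)
        have h2 : Tendsto (fun p : ℕ × ℕ => (p.1, p.2)) atTop atTop := tendsto_id
        have a1 := (huv o).comp h1
        have a2 := (hvw o).comp h2
        rw [tendsto_atTop]
        intro b
        filter_upwards [tendsto_atTop.1 a1 (b + δ), tendsto_atTop.1 a2 (b + δ)] with p hp hq
        have := hδ o (u.1 p.1) (v.1 p.1) (w.1 p.2)
        have := le_min hp hq
        simp only [Function.comp] at this
        linarith }

/-- The (sequential) Gromov boundary of a hyperbolic space. -/
def GromovBoundary (X : Type*) [MetricSpace X] [GromovHyperbolicSpace X] : Type _ :=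
  Quotient (boundarySetoid X)

/-- The sequence `u` converges to the boundary point `ξ`. -/
def TendsToBoundary {X : Type*} [MetricSpace X] [GromovHyperbolicSpace X]
    (u : ℕ → X) (ξ : GromovBoundary X) : Prop :=
  ∃ hu : ConvergesAtInfinity u, (Quotient.mk (boundarySetoid X) ⟨u, hu⟩ : GromovBoundary X) = ξ

/-- Any two distinct boundary points are the endpoints of a bi-infinite geodesic. -/
def IsVisibilitySpace (X : Type*) [MetricSpace X] [GromovHyperbolicSpace X] : Prop :=
  ∀ ξ η : GromovBoundary X, ξ ≠ η → ∃ γ : ℝ → X, Isometry γ ∧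
    TendsToBoundary (fun n : ℕ => γ (-(n : ℝ))) ξ ∧ TendsToBoundary (fun n : ℕ => γ n) η

theorem gromovProduct_isometryEquiv {X : Type*} [MetricSpace X] (A : X ≃ᵢ X) (o x y : X) :
    gromovProduct o (A x) (A y) = gromovProduct (A.symm o) x y := by
  unfold gromovProduct
  have h (z : X) : dist (A z) o = dist z (A.symm o) := by
    rw [← A.dist_eq z, A.apply_symm_apply]
  rw [h, h, A.dist_eq]

/-- The action of an isometry on the Gromov boundary. -/
def GromovBoundary.map {X : Type*} [MetricSpace X] [GromovHyperbolicSpace X] (A : X ≃ᵢ X) :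
    GromovBoundary X → GromovBoundary X :=
  Quotient.map (sa := boundarySetoid X) (sb := boundarySetoid X)
    (fun u => ⟨fun n => A (u.1 n), fun o => by
      simpa only [gromovProduct_isometryEquiv] using u.2 (A.symm o)⟩)
    (fun u v (h : ∀ o : X, Tendsto
        (fun p : ℕ × ℕ => gromovProduct o (u.1 p.1) (v.1 p.2)) atTop atTop) o => by
      simpa only [gromovProduct_isometryEquiv] using h (A.symm o))

/-! ### Quasi-geodesics and hyperbolic isometries -/

/-- A bi-infinite `(lam, k)`-quasi-geodesic sequence of points. -/
def IsQuasiGeodesic {X : Type*} [MetricSpace X] (lam k : ℝ) (x : ℤ → X) : Prop :=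
  ∀ n m : ℤ, 1 / lam * |(n : ℝ) - m| - k ≤ dist (x n) (x m) ∧
    dist (x n) (x m) ≤ lam * |(n : ℝ) - m| + k

/-- An isometry is hyperbolic if `n ↦ A ^ n o` is a quasi-isometric embedding of `ℤ`
(for one, equivalently for every, point `o`). -/
def IsHyperbolicIsometry {X : Type*} [MetricSpace X] (A : X ≃ᵢ X) : Prop :=
  ∃ o : X, ∃ lam > 0, ∃ k ≥ 0, IsQuasiGeodesic lam k (fun n : ℤ => (A ^ n) o)

theorem dist_zpow_apply {X : Type*} [MetricSpace X] (A : X ≃ᵢ X) (n m : ℤ) (o : X) :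
    dist ((A ^ n) o) ((A ^ m) o) = dist ((A ^ (n - m)) o) o := by
  have : (A ^ n) o = (A ^ m) ((A ^ (n - m)) o) := by
    rw [← IsometryEquiv.mul_apply, ← zpow_add]
    congr 2
    ring
  rw [this, (A ^ m).dist_eq]

/-- The orbit of a hyperbolic isometry grows at least linearly. -/
theorem IsHyperbolicIsometry.exists_linear_growth {X : Type*} [MetricSpace X] {A : X ≃ᵢ X}
    (hA : IsHyperbolicIsometry A) (o : X) :
    ∃ c > 0, ∃ K : ℝ, ∀ n : ℤ, c * |(n : ℝ)| - K ≤ dist ((A ^ n) o) o := by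
  obtain ⟨o', lam, hlam, k, -, h⟩ := hA
  refine ⟨1 / lam, by positivity, k + 2 * dist o o', fun n => ?_⟩
  have h1 := (h n 0).1
  have h2 : dist ((A ^ n) o) ((A ^ n) o') = dist o o' := (A ^ n).dist_eq _ _
  have h3 := dist_triangle4 ((A ^ n) o') ((A ^ n) o) o o'
  rw [dist_comm ((A ^ n) o') ((A ^ n) o)] at h3
  simp only [zpow_zero, Int.cast_zero, sub_zero, IsometryEquiv.coe_one, id] at h1
  linarith

/-- The positive orbit of a hyperbolic isometry converges at infinity. -/
theorem IsHyperbolicIsometry.convergesAtInfinity {X : Type*} [MetricSpace X]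
    [GromovHyperbolicSpace X] {A : X ≃ᵢ X} (hA : IsHyperbolicIsometry A) (o : X) :
    ConvergesAtInfinity (fun n : ℕ => (A ^ (n : ℤ)) o) := by
  obtain ⟨δ, hδ⟩ := GromovHyperbolicSpace.exists_delta (X := X)
  have hδ0 : 0 ≤ δ := by
    have := hδ o o o o
    simp [gromovProduct] at this
    exact this
  obtain ⟨c, hc, K, hK⟩ := hA.exists_linear_growth o
  set u : ℕ → X := fun n => (A ^ (n : ℤ)) o with hu
  have hK' (n : ℕ) : c * n - K ≤ dist (u n) o := by
    have := hK n
    rw [Int.cast_natCast, abs_of_nonneg (Nat.cast_nonneg n)] at this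
    exact this
  have hdist (i n : ℕ) : dist (u i) (u (i + n)) = dist (u n) o := by
    rw [dist_comm]
    simp only [hu]
    rw [dist_zpow_apply]
    congr 3
    push_cast
    ring
  obtain ⟨p, hp⟩ := exists_nat_gt (max 0 (δ / c))
  have hp0 : 0 < p := by
    have := lt_of_le_of_lt (le_max_left _ _) hp
    exact_mod_cast this
  have hpδ : δ ≤ c * p := by
    have := lt_of_le_of_lt (le_max_right _ _) hp
    rw [div_lt_iff₀ hc] at this
    linarith
  set K' : ℝ := K + dist (u p) o / 2 with hK'def
  have hcp : 0 ≤ c * p := by positivity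
  have hstep (q : ℕ) : c * p * q - K' ≤ gromovProduct o (u (p * q)) (u (p * (q + 1))) := by
    unfold gromovProduct
    have h1 := hK' (p * q)
    have h2 := hK' (p * (q + 1))
    have h3 : dist (u (p * q)) (u (p * (q + 1))) = dist (u p) o := hdist (p * q) p
    push_cast at h1 h2
    rw [h3]
    linarith
  have hchain (j : ℕ) : ∀ q : ℕ,
      c * p * q - K' - δ ≤ gromovProduct o (u (p * q)) (u (p * (q + j))) := by
    induction j with
    | zero =>
      intro q
      have h1 := hK' (p * q)
      push_cast at h1
      have h2 : (0 : ℝ) ≤ dist (u p) o := dist_nonneg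
      simp only [gromovProduct, add_zero, dist_self]
      linarith
    | succ j ih =>
      intro q
      have h1 := hstep q
      have h2 := ih (q + 1)
      have h3 := hδ o (u (p * q)) (u (p * (q + 1))) (u (p * (q + 1 + j)))
      have h4 : c * p * q - K' ≤ min (gromovProduct o (u (p * q)) (u (p * (q + 1))))
          (gromovProduct o (u (p * (q + 1))) (u (p * (q + 1 + j)))) := by
        refine le_min h1 ?_
        push_cast at h2
        linarith
      have h5 : q + (j + 1) = q + 1 + j := by ring
      rw [h5]
      linarith
  set M : ℝ := ∑ r ∈ Finset.range p, dist (u r) o with hM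
  have hnear (n : ℕ) : dist (u (p * (n / p))) (u n) ≤ M := by
    have h1 := hdist (p * (n / p)) (n % p)
    rw [Nat.div_add_mod] at h1
    rw [h1]
    exact Finset.single_le_sum (f := fun r => dist (u r) o) (fun _ _ => dist_nonneg)
      (Finset.mem_range.2 (Nat.mod_lt _ hp0))
  have hmain (i j : ℕ) (hij : i ≤ j) :
      c * i - c * p - K' - δ - 2 * M ≤ gromovProduct o (u i) (u j) := by
    obtain ⟨d, hd⟩ := Nat.exists_eq_add_of_le (Nat.div_le_div_right (c := p) hij)
    have h1 := hchain d (i / p)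
    rw [← hd] at h1
    have h2 := hnear i
    have h3 := hnear j
    have h4 := dist_triangle (u (p * (i / p))) (u i) o
    have h5 := dist_triangle (u (p * (j / p))) (u j) o
    have h6 := dist_triangle4 (u i) (u (p * (i / p))) (u (p * (j / p))) (u j)
    rw [dist_comm (u i) (u (p * (i / p)))] at h6
    have h7 : (i : ℝ) ≤ p * (i / p : ℕ) + p := by
      have h8 := Nat.div_add_mod i p
      have h9 := Nat.mod_lt i hp0
      exact_mod_cast (by omega : i ≤ p * (i / p) + p)
    have h8 : c * i ≤ c * (p * (i / p : ℕ) + p) := mul_le_mul_of_nonneg_left h7 hc.le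
    unfold gromovProduct at h1 ⊢
    linarith
  intro o'
  rw [tendsto_atTop]
  intro b
  obtain ⟨n₀, hn₀⟩ := exists_nat_gt
    ((b + c * p + K' + δ + 2 * M + dist o o') / c)
  rw [div_lt_iff₀ hc] at hn₀
  filter_upwards [eventually_ge_atTop (n₀, n₀)] with q hq
  have hq1 : n₀ ≤ q.1 := hq.1
  have hq2 : n₀ ≤ q.2 := hq.2
  have hbase : gromovProduct o (u q.1) (u q.2) - dist o o' ≤
      gromovProduct o' (u q.1) (u q.2) := by
    have h1 := dist_triangle (u q.1) o' o
    have h2 := dist_triangle (u q.2) o' o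
    rw [dist_comm o' o] at h1 h2
    unfold gromovProduct
    linarith
  rcases le_total q.1 q.2 with h | h
  · have h1 := hmain _ _ h
    have h2 : c * (n₀ : ℝ) ≤ c * q.1 :=
      mul_le_mul_of_nonneg_left (by exact_mod_cast hq1) hc.le
    linarith
  · have h1 := hmain _ _ h
    rw [gromovProduct_comm] at h1
    have h2 : c * (n₀ : ℝ) ≤ c * q.2 :=
      mul_le_mul_of_nonneg_left (by exact_mod_cast hq2) hc.le
    linarith

theorem IsHyperbolicIsometry.inv {X : Type*} [MetricSpace X] {A : X ≃ᵢ X}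
    (hA : IsHyperbolicIsometry A) : IsHyperbolicIsometry A⁻¹ := by
  obtain ⟨o, lam, hlam, k, hk, h⟩ := hA
  refine ⟨o, lam, hlam, k, hk, fun n m => ?_⟩
  have h1 := h (-n) (-m)
  have h2 : |((-n : ℤ) : ℝ) - ((-m : ℤ) : ℝ)| = |(n : ℝ) - m| := by
    push_cast
    rw [← abs_neg]
    congr 1
    ring
  rw [h2] at h1
  simpa only [inv_zpow'] using h1

/-- The attracting point `A⁺` of a hyperbolic isometry: the limit of `A ^ n o` as `n → +∞`
(it does not depend on `o`). -/
def attractingPoint {X : Type*} [MetricSpace X] [GromovHyperbolicSpace X] (A : X ≃ᵢ X)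
    (hA : IsHyperbolicIsometry A) (o : X) : GromovBoundary X :=
  Quotient.mk (boundarySetoid X) ⟨fun n : ℕ => (A ^ (n : ℤ)) o, hA.convergesAtInfinity o⟩

/-- The repelling point `A⁻` of a hyperbolic isometry: the limit of `A ^ (-n) o`, that is,
the attracting point of the inverse. -/
def repellingPoint {X : Type*} [MetricSpace X] [GromovHyperbolicSpace X] (A : X ≃ᵢ X)
    (hA : IsHyperbolicIsometry A) (o : X) : GromovBoundary X :=
  attractingPoint A⁻¹ hA.inv o

/-! ### Bi-infinite words -/

/-- The alphabet `{G, G⁻¹, D₁, D₁⁻¹, D₂, D₂⁻¹}` (formal letters). -/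
inductive Letter : Type
  | G | Ginv | D₁ | D₁inv | D₂ | D₂inv

/-- The formal inverse of a letter. -/
def Letter.inv : Letter → Letter
  | .G => .Ginv
  | .Ginv => .G
  | .D₁ => .D₁inv
  | .D₁inv => .D₁
  | .D₂ => .D₂inv
  | .D₂inv => .D₂

/-- The letter is `G` or `G⁻¹`. -/
def Letter.IsG (l : Letter) : Prop := l = .G ∨ l = .Ginv

/-- The letter is `D₁` or `D₁⁻¹`. -/
def Letter.IsD₁ (l : Letter) : Prop := l = .D₁ ∨ l = .D₁inv

/-- The letter is `D₂` or `D₂⁻¹`. -/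
def Letter.IsD₂ (l : Letter) : Prop := l = .D₂ ∨ l = .D₂inv

/-- The isometry denoted by a letter. -/
def Letter.eval {X : Type*} [MetricSpace X] (G D₁ D₂ : X ≃ᵢ X) : Letter → (X ≃ᵢ X)
  | .G => G
  | .Ginv => G⁻¹
  | .D₁ => D₁
  | .D₁inv => D₁⁻¹
  | .D₂ => D₂
  | .D₂inv => D₂⁻¹

/-- The isometry denoted by the finite word `W n` associated with a bi-infinite word `H`:
`H 0 * ⋯ * H (n - 1)` for `n ≥ 0` and `(H (-1))⁻¹ * ⋯ * (H n)⁻¹` for `n < 0`. -/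
def partialWord {X : Type*} [MetricSpace X] (G D₁ D₂ : X ≃ᵢ X) (H : ℤ → Letter) :
    ℤ → (X ≃ᵢ X)
  | Int.ofNat n => ((List.range n).map fun i : ℕ => (H (i : ℤ)).eval G D₁ D₂).prod
  | Int.negSucc n =>
      ((List.range (n + 1)).map fun i : ℕ => (H (-(i : ℤ) - 1)).inv.eval G D₁ D₂).prod

/-- Reduced bi-infinite words of the form
`⋯ D₁^{±1} G⁻¹⋯G⁻¹ D₂^{±1} G⋯G D₁^{±1} G⁻¹⋯G⁻¹ D₂^{±1} G⋯G ⋯`,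
all blocks of letters `G^{±1}` between two letters `D_i^{±1}` having length at least `N`.
The word may contain only finitely many letters `D_i^{±1}` (or none): it then ends with an infinite
block of letters `G^{±1}`, which has to have the same sign as the finite blocks in its position
(the four `tail` conditions). -/
structure IsAdmissibleWord (N : ℕ) (H : ℤ → Letter) : Prop where
  reduced : ∀ n, H n ≠ (H (n + 1)).inv
  after_D₁ : ∀ n₁ n₂, n₁ < n₂ → (H n₁).IsD₁ → (H n₂).IsD₁ ∨ (H n₂).IsD₂ →
    (∀ n, n₁ < n → n < n₂ → (H n).IsG) →
      (H n₂).IsD₂ ∧ (∀ n, n₁ < n → n < n₂ → H n = .Ginv) ∧ (N : ℤ) ≤ n₂ - n₁ - 1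
  after_D₂ : ∀ n₁ n₂, n₁ < n₂ → (H n₁).IsD₂ → (H n₂).IsD₁ ∨ (H n₂).IsD₂ →
    (∀ n, n₁ < n → n < n₂ → (H n).IsG) →
      (H n₂).IsD₁ ∧ (∀ n, n₁ < n → n < n₂ → H n = .G) ∧ (N : ℤ) ≤ n₂ - n₁ - 1
  right_tail_D₁ : ∀ n₀, (H n₀).IsD₁ → (∀ n, n₀ < n → (H n).IsG) → ∀ n, n₀ < n → H n = .Ginv
  right_tail_D₂ : ∀ n₀, (H n₀).IsD₂ → (∀ n, n₀ < n → (H n).IsG) → ∀ n, n₀ < n → H n = .G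
  left_tail_D₁ : ∀ n₀, (H n₀).IsD₁ → (∀ n, n < n₀ → (H n).IsG) → ∀ n, n < n₀ → H n = .G
  left_tail_D₂ : ∀ n₀, (H n₀).IsD₂ → (∀ n, n < n₀ → (H n).IsG) → ∀ n, n < n₀ → H n = .Ginv

/-! In a hyperbolic space, quasi-geodesicity can be checked locally. A chain whose inner vertices
have Gromov products at most `C` and whose steps have length at least `2 * C + 4 * δ + 1` makes
linear progress (`IsDeltaHyperbolic.le_dist_of_chain`). A Lipschitz sequence is therefore a
quasi-geodesic once all its pieces of length at most `2 * p` are coarsely straight with constants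
`c`, `C`, for some `p` large compared with `C`, `δ` and `1 / c`
(`IsDeltaHyperbolic.isQuasiGeodesic_of_isCoarselyStraight`). What is needed are straightness
constants that do not depend on `N`.

A piece of length at most `N` contains at most one letter `D_i^{±1}`. If it contains none, it runs
along an orbit of `G`, on which distances are additive up to a bounded error
(`IsHyperbolicIsometry.exists_excess_le`). If it contains one, then seen from the vertex before that
letter the two arms are `A ^ s o` and `D_i^{±1} A ^ t o`, with `A = G⁻¹` for `D₁` and `A = G` for
`D₂`: this is what the prescribed signs achieve. As `D_i` moves the attracting point of `A`, the
arms have different limits and hence bounded Gromov product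
(`IsHyperbolicIsometry.exists_isCoarselyStraight_turn`). Finally `p` is chosen from these constants,
and `N = 2 * p`. -/

/-! ### Chains with long steps and small Gromov products -/

section LocalToGlobal

variable {X : Type*} [MetricSpace X] {δ C : ℝ}

theorem IsDeltaHyperbolic.delta_nonneg (hδ : IsDeltaHyperbolic X δ) (o : X) : 0 ≤ δ := by
  have := hδ o o o o
  simp [gromovProduct] at this
  exact this

theorem gromovProduct_le_dist (o x y : X) : gromovProduct o x y ≤ dist x o := by
  have := dist_triangle y x o
  rw [dist_comm y x] at this
  unfold gromovProduct
  linarith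

/-- In a chain with long steps and small Gromov products at the inner vertices, the Gromov product
at a vertex of its predecessor and any later vertex stays small. -/
theorem IsDeltaHyperbolic.gromovProduct_succ_le (hδ : IsDeltaHyperbolic X δ) (hC : 0 ≤ C)
    {x : ℤ → X} (hprod : ∀ i, gromovProduct (x (i + 1)) (x i) (x (i + 2)) ≤ C)
    (hstep : ∀ i, 2 * C + 4 * δ + 1 ≤ dist (x i) (x (i + 1))) (n : ℕ) :
    ∀ i, gromovProduct (x (i + 1)) (x i) (x (i + 1 + n)) ≤ C + δ := by
  have hδ0 := hδ.delta_nonneg (x 0)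
  induction n with
  | zero =>
    intro i
    simp only [gromovProduct, Nat.cast_zero, add_zero, dist_self]
    linarith
  | succ n ih =>
    intro i
    have h1 := ih (i + 1)
    have h2 := hstep (i + 1)
    have h3 := hδ (x (i + 1)) (x i) (x (i + 1 + (n + 1 : ℕ))) (x (i + 2))
    have h4 := hprod i
    have e1 : i + 1 + 1 = i + 2 := by ring
    have e2 : i + 2 + (n : ℤ) = i + 1 + (n + 1 : ℕ) := by push_cast; ring
    rw [e1, e2] at h1
    rw [e1] at h2
    have h5 : gromovProduct (x (i + 1)) (x (i + 1 + (n + 1 : ℕ))) (x (i + 2)) =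
        dist (x (i + 1)) (x (i + 2)) -
          gromovProduct (x (i + 2)) (x (i + 1)) (x (i + 1 + (n + 1 : ℕ))) := by
      unfold gromovProduct
      rw [dist_comm (x (i + 2)) (x (i + 1)),
        dist_comm (x (i + 1)) (x (i + 1 + (n + 1 : ℕ)))]
      ring
    -- By `h1` and `h2` the second product is at least `C + 3 * δ + 1`, too large to be the minimum,
    -- so the bound `C + δ` falls on the first.
    rcases min_cases (gromovProduct (x (i + 1)) (x i) (x (i + 1 + (n + 1 : ℕ))))
      (gromovProduct (x (i + 1)) (x (i + 1 + (n + 1 : ℕ))) (x (i + 2))) with h | h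
    · linarith
    · linarith

/-- Each step contributes at least `2 * C + 4 * δ + 1` and loses at most `2 * (C + δ)` by
backtracking, a net gain of at least `1`. -/
theorem IsDeltaHyperbolic.le_dist_of_chain (hδ : IsDeltaHyperbolic X δ) (hC : 0 ≤ C)
    {x : ℤ → X} (hprod : ∀ i, gromovProduct (x (i + 1)) (x i) (x (i + 2)) ≤ C)
    (hstep : ∀ i, 2 * C + 4 * δ + 1 ≤ dist (x i) (x (i + 1))) (n : ℕ) :
    ∀ i, (n : ℝ) ≤ dist (x i) (x (i + n)) := by
  have hδ0 := hδ.delta_nonneg (x 0)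
  induction n with
  | zero => simp
  | succ n ih =>
    intro i
    have h1 := hδ.gromovProduct_succ_le hC hprod hstep n i
    have h2 := ih (i + 1)
    have h3 := hstep i
    have e : i + 1 + (n : ℤ) = i + (n + 1 : ℕ) := by push_cast; ring
    rw [e] at h1 h2
    unfold gromovProduct at h1
    rw [dist_comm (x (i + (n + 1 : ℕ))) (x (i + 1))] at h1
    push_cast at h1 h2 ⊢
    linarith

/-- The one-sided bound for the reversed chain shows that, seen from `x i`, the earlier vertices lie
in the direction of `x (i - 1)`. Replacing `x (i - 1)` by one of them in the forward bound costs one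
more `δ`. -/
theorem IsDeltaHyperbolic.gromovProduct_le_of_chain (hδ : IsDeltaHyperbolic X δ) (hC : 0 ≤ C)
    {x : ℤ → X} (hprod : ∀ i, gromovProduct (x (i + 1)) (x i) (x (i + 2)) ≤ C)
    (hstep : ∀ i, 2 * C + 4 * δ + 1 ≤ dist (x i) (x (i + 1))) (i : ℤ) (m n : ℕ) :
    gromovProduct (x i) (x (i - m)) (x (i + n)) ≤ C + 2 * δ := by
  have hδ0 := hδ.delta_nonneg (x 0)
  rcases m with _ | m
  · simp only [gromovProduct, Nat.cast_zero, sub_zero, dist_self,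
      dist_comm (x (i + n)) (x i)]
    linarith
  have hrev : gromovProduct (x (i - 1)) (x i) (x (i - 1 - m)) ≤ C + δ := by
    have := hδ.gromovProduct_succ_le (x := fun j => x (-j)) hC
      (fun j => by
        have := hprod (-j - 2)
        rw [gromovProduct_comm] at this
        convert this using 3 <;> ring)
      (fun j => by
        have := hstep (-j - 1)
        rw [dist_comm] at this
        convert this using 3 <;> ring) m (-i)
    convert this using 3 <;> ring
  have h1 := hδ.gromovProduct_succ_le hC hprod hstep n (i - 1)
  have h2 := hstep (i - 1)
  rw [sub_add_cancel] at h1 h2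
  have e : i - 1 - (m : ℤ) = i - (m + 1 : ℕ) := by push_cast; ring
  rw [e] at hrev
  have h3 := hδ (x i) (x (i - 1)) (x (i - (m + 1 : ℕ))) (x (i + n))
  have h4 : gromovProduct (x i) (x (i - 1)) (x (i - (m + 1 : ℕ))) =
      dist (x (i - 1)) (x i) - gromovProduct (x (i - 1)) (x i) (x (i - (m + 1 : ℕ))) := by
    unfold gromovProduct
    rw [dist_comm (x i) (x (i - 1)), dist_comm (x (i - 1)) (x (i - (m + 1 : ℕ))),
      dist_comm (x (i - (m + 1 : ℕ))) (x i)]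
    ring
  rcases min_cases (gromovProduct (x i) (x (i - 1)) (x (i - (m + 1 : ℕ))))
    (gromovProduct (x i) (x (i - (m + 1 : ℕ))) (x (i + n))) with h | h
  · linarith
  · linarith

end LocalToGlobal

/-! ### Orbits of a hyperbolic isometry and their limits -/

section Orbits

variable {X : Type*} [MetricSpace X]

/-- Some power of a hyperbolic isometry moves `o` far less than its square does. -/
theorem IsHyperbolicIsometry.exists_dist_sq_ge {A : X ≃ᵢ X} (hA : IsHyperbolicIsometry A) (o : X)
    (L : ℝ) : ∃ p : ℕ, 0 < p ∧
      dist ((A ^ (p : ℤ)) o) o + L ≤ dist ((A ^ ((2 * p : ℕ) : ℤ)) o) o := by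
  by_contra! hcon
  obtain ⟨c, hc, K, hK⟩ := hA.exists_linear_growth o
  -- If doubling the exponent always added less than `L`, the displacement would grow only
  -- logarithmically in the exponent, against the linear growth `hK`.
  have hup (k : ℕ) : dist ((A ^ ((2 ^ k : ℕ) : ℤ)) o) o ≤ dist ((A ^ (1 : ℤ)) o) o + k * L := by
    induction k with
    | zero => simp
    | succ k ih =>
      have h1 := hcon (2 ^ k) (by positivity)
      rw [← pow_succ'] at h1
      push_cast at h1 ih ⊢
      linarith
  set a := dist ((A ^ (1 : ℤ)) o) o
  obtain ⟨k, hk⟩ := exists_nat_gt (max ((2 * L + 1) / c) (max (K + a) 0))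
  have hk1 := lt_of_le_of_lt (le_max_left _ _) hk
  have hk2 := lt_of_le_of_lt (le_max_left _ _) (lt_of_le_of_lt (le_max_right _ _) hk)
  have hk0 := lt_of_le_of_lt (le_max_right _ _) (lt_of_le_of_lt (le_max_right _ _) hk)
  rw [div_lt_iff₀ hc] at hk1
  -- The exponent `2 * k` makes the crude bound `k * k ≤ 2 ^ (2 * k)` sufficient.
  have h1 := hup (2 * k)
  have h2 := hK ((2 ^ (2 * k) : ℕ) : ℤ)
  rw [Int.cast_natCast, abs_of_nonneg (Nat.cast_nonneg _)] at h2
  have h3 : (k : ℝ) * k ≤ ((2 ^ (2 * k) : ℕ) : ℝ) := by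
    have h4 : k ≤ 2 ^ k := Nat.lt_two_pow_self.le
    have h5 : k * k ≤ 2 ^ (2 * k) := by
      rw [two_mul, pow_add]
      exact Nat.mul_le_mul h4 h4
    exact_mod_cast h5
  have h6 := mul_le_mul_of_nonneg_left h3 hc.le
  have h7 := mul_lt_mul_of_pos_right hk1 hk0
  rw [Nat.cast_mul, Nat.cast_two] at h1
  linarith

/-- The orbit of a hyperbolic isometry is, up to a bounded error, additive. -/
theorem IsHyperbolicIsometry.exists_excess_le [GromovHyperbolicSpace X] {A : X ≃ᵢ X}
    (hA : IsHyperbolicIsometry A) (o : X) : ∃ C, ∀ i j k : ℤ, i ≤ j → j ≤ k →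
      dist ((A ^ i) o) ((A ^ j) o) + dist ((A ^ j) o) ((A ^ k) o) ≤
        dist ((A ^ i) o) ((A ^ k) o) + C := by
  obtain ⟨δ, hδ⟩ := GromovHyperbolicSpace.exists_delta (X := X)
  obtain ⟨p, hp, hpL⟩ := hA.exists_dist_sq_ge o (4 * δ + 1)
  set a : ℤ → ℝ := fun n => dist ((A ^ n) o) o with ha
  have haneg (n : ℤ) : a (-n) = a n := by
    have := dist_zpow_apply A 0 n o
    simp only [zero_sub, zpow_zero, IsometryEquiv.coe_one, id] at this
    simp only [ha]
    rw [← this, dist_comm]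
  have hdist (i j : ℤ) : dist ((A ^ i) o) ((A ^ j) o) = a (j - i) := by
    rw [dist_comm, dist_zpow_apply]
  set x : ℤ → X := fun i => (A ^ (p * i)) o with hx
  -- This is the Gromov product at each inner vertex of the chain `x`; the step condition `2 * C + 4
  -- * δ + 1 ≤ a p` then says exactly `hpL`.
  set C : ℝ := a p - a (2 * p) / 2 with hCdef
  have hC : 0 ≤ C := by
    have h1 := dist_triangle ((A ^ (2 * p : ℤ)) o) ((A ^ (p : ℤ)) o) o
    rw [dist_zpow_apply, show (2 * p - p : ℤ) = p by ring] at h1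
    simp only [hCdef, ha]
    linarith
  have hmid := hδ.gromovProduct_le_of_chain (x := x) hC
    (fun i => by
      simp only [gromovProduct, hx]
      rw [hdist, hdist, hdist, show (p * (i + 1) - p * i : ℤ) = p by ring,
        show (p * (i + 1) - p * (i + 2) : ℤ) = -p by ring,
        show (p * (i + 2) - p * i : ℤ) = 2 * p by ring, haneg]
      linarith)
    (fun i => by
      simp only [hx]
      rw [hdist, show (p * (i + 1) - p * i : ℤ) = p by ring]
      push_cast at hpL
      simp only [hCdef, ha]
      linarith) 0
  set M : ℝ := ∑ r ∈ Finset.range p, a r with hM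
  have hnear (r : ℤ) (h0 : 0 ≤ r) (hr : r < p) : a r ≤ M := by
    lift r to ℕ using h0
    exact Finset.single_le_sum (f := fun r : ℕ => a r) (fun _ _ => dist_nonneg)
      (Finset.mem_range.2 (by exact_mod_cast hr))
  -- Rounding `s` and `t` down to multiples of `p` takes four triangle inequalities, each costing at
  -- most `M`.
  have hcentral (s t : ℕ) : a s + a t ≤ a (s + t) + (2 * (C + 2 * δ) + 4 * M) := by
    have h1 := hmid (s / p) (t / p)
    have hs := Nat.div_add_mod s p
    have ht := Nat.div_add_mod t p
    simp only [gromovProduct, hx] at h1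
    rw [hdist, hdist, hdist] at h1
    have es : (s : ℤ) - p * (s / p : ℕ) = (s % p : ℕ) := by
      rw [sub_eq_iff_eq_add']; exact_mod_cast hs.symm
    have et : (t : ℤ) - p * (t / p : ℕ) = (t % p : ℕ) := by
      rw [sub_eq_iff_eq_add']; exact_mod_cast ht.symm
    have hsM := hnear (s % p : ℕ) (by positivity) (by exact_mod_cast Nat.mod_lt _ hp)
    have htM := hnear (t % p : ℕ) (by positivity) (by exact_mod_cast Nat.mod_lt _ hp)
    have tri (m n : ℤ) : a (m + n) ≤ a m + a n := by
      have h1 := dist_triangle ((A ^ (m + n)) o) ((A ^ n) o) o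
      rwa [dist_zpow_apply, add_sub_cancel_right] at h1
    set i : ℤ := p * (s / p : ℕ) with hi
    set j : ℤ := p * (t / p : ℕ) with hj
    have e1 : (p : ℤ) * 0 - p * (0 - (s / p : ℕ)) = i := by rw [hi]; ring
    have e2 : (p : ℤ) * 0 - p * (0 + (t / p : ℕ)) = -j := by rw [hj]; ring
    have e3 : (p : ℤ) * (0 + (t / p : ℕ)) - p * (0 - (s / p : ℕ)) = i + j := by
      rw [hi, hj]; ring
    rw [e1, e2, e3, haneg] at h1
    have h2 := tri (s - i) i
    have h3 := tri (t - j) j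
    have h4 : a (i + j) ≤ a (s - i) + a (s + j) := by
      have h := tri (-(s - i)) (s + j)
      rwa [haneg, show -((s : ℤ) - i) + (s + j) = i + j by ring] at h
    have h5 : a (s + j) ≤ a (t - j) + a (s + t) := by
      have h := tri (-(t - j)) (s + t)
      rwa [haneg, show -((t : ℤ) - j) + (s + t) = s + j by ring] at h
    rw [sub_add_cancel, es] at h2
    rw [sub_add_cancel, et] at h3
    rw [es] at h4
    rw [et] at h5
    linarith
  refine ⟨2 * (C + 2 * δ) + 4 * M, fun i j k hij hjk => ?_⟩
  obtain ⟨s, rfl⟩ := Int.le.dest hij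
  obtain ⟨t, rfl⟩ := Int.le.dest hjk
  rw [hdist, hdist, hdist, show i + (s : ℤ) - i = s by ring,
    show i + (s : ℤ) + t - (i + s) = t by ring, show i + (s : ℤ) + t - i = s + t by ring]
  exact hcentral s t

/-- Sequences with different limits in the boundary have bounded Gromov products. -/
theorem exists_gromovProduct_le_of_not_tendsto [GromovHyperbolicSpace X] {u v : ℕ → X} (o : X)
    (hu : ConvergesAtInfinity u) (hv : ConvergesAtInfinity v)
    (huv : ¬ Tendsto (fun p : ℕ × ℕ => gromovProduct o (u p.1) (v p.2)) atTop atTop) :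
    ∃ C, ∀ i j, gromovProduct o (u i) (v j) ≤ C := by
  obtain ⟨δ, hδ⟩ := GromovHyperbolicSpace.exists_delta (X := X)
  have hδ0 := hδ.delta_nonneg o
  rw [tendsto_atTop] at huv
  push Not at huv
  obtain ⟨b, hb⟩ := huv
  have h1 := tendsto_atTop.1 (hu o) (b + 2 * δ)
  have h2 := tendsto_atTop.1 (hv o) (b + 2 * δ)
  rw [eventually_atTop] at h1 h2
  obtain ⟨⟨m₁, m₂⟩, h1⟩ := h1
  obtain ⟨⟨m₃, m₄⟩, h2⟩ := h2
  set M := max (max m₁ m₂) (max m₃ m₄) with hM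
  obtain ⟨⟨n, m⟩, hnm, hlt⟩ := hb.forall_exists_of_atTop (M, M)
  have hn : M ≤ n := hnm.1
  have hm : M ≤ m := hnm.2
  have hlt' : gromovProduct o (u n) (v m) < b := hlt
  set S : ℝ := ∑ r ∈ Finset.range M, (dist (u r) o + dist (v r) o) with hS
  have hsum (r : ℕ) (hr : r < M) : dist (u r) o + dist (v r) o ≤ S :=
    Finset.single_le_sum (f := fun r : ℕ => dist (u r) o + dist (v r) o)
      (fun _ _ => by positivity) (Finset.mem_range.2 hr)
  refine ⟨max S (b + 2 * δ), fun i j => ?_⟩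
  rcases lt_or_ge i M with hi | hi
  · have h3 := gromovProduct_le_dist o (u i) (v j)
    have h4 := hsum i hi
    have h5 : 0 ≤ dist (v i) o := dist_nonneg
    exact le_max_of_le_left (by linarith)
  rcases lt_or_ge j M with hj | hj
  · have h3 := gromovProduct_le_dist o (v j) (u i)
    rw [gromovProduct_comm] at h3
    have h4 := hsum j hj
    have h5 : 0 ≤ dist (u j) o := dist_nonneg
    exact le_max_of_le_left (by linarith)
  refine le_max_of_le_right ?_
  have h3 : b + 2 * δ ≤ gromovProduct o (u n) (u i) :=
    h1 (n, i) ⟨by simp; omega, by simp; omega⟩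
  have h4 : b + 2 * δ ≤ gromovProduct o (v j) (v m) :=
    h2 (j, m) ⟨by simp; omega, by simp; omega⟩
  have h5 := hδ o (u n) (u i) (v m)
  have h6 := hδ o (u i) (v j) (v m)
  -- Otherwise two four-point inequalities, through `v j` and then `u i`, would lift the product of
  -- `u n` and `v m` to at least `b`.
  by_contra! hcon
  have h8 : b + 2 * δ ≤ min (gromovProduct o (u i) (v j)) (gromovProduct o (v j) (v m)) :=
    le_min hcon.le h4
  have h9 : b + δ ≤ min (gromovProduct o (u n) (u i)) (gromovProduct o (u i) (v m)) :=
    le_min (by linarith) (by linarith)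
  linarith

/-- An isometry moving the attracting point of `A` maps the positive orbit of `A` to a sequence
leaving `o` in another direction. -/
theorem IsHyperbolicIsometry.exists_excess_map_le [GromovHyperbolicSpace X] {A : X ≃ᵢ X}
    (hA : IsHyperbolicIsometry A) (o : X) (D : X ≃ᵢ X)
    (hD : GromovBoundary.map D (attractingPoint A hA o) ≠ attractingPoint A hA o) :
    ∃ C, ∀ s t : ℕ, dist ((A ^ (s : ℤ)) o) o + dist o (D ((A ^ (t : ℤ)) o)) ≤
      dist ((A ^ (s : ℤ)) o) (D ((A ^ (t : ℤ)) o)) + C := by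
  have hu := hA.convergesAtInfinity o
  have hv : ConvergesAtInfinity (fun n : ℕ => D ((A ^ (n : ℤ)) o)) := fun o' => by
    simpa only [gromovProduct_isometryEquiv] using hu (D.symm o')
  have hne : ¬ ∀ o' : X, Tendsto (fun p : ℕ × ℕ =>
      gromovProduct o' ((A ^ (p.1 : ℤ)) o) (D ((A ^ (p.2 : ℤ)) o))) atTop atTop := fun h =>
    hD (Quotient.sound (s := boundarySetoid X)
      (a := ⟨fun n : ℕ => D ((A ^ (n : ℤ)) o), hv⟩) (b := ⟨_, hu⟩)
      ((boundarySetoid X).symm' (x := ⟨_, hu⟩)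
        (y := ⟨fun n : ℕ => D ((A ^ (n : ℤ)) o), hv⟩) h))
  push Not at hne
  obtain ⟨o', ho'⟩ := hne
  obtain ⟨C, hC⟩ := exists_gromovProduct_le_of_not_tendsto o' hu hv ho'
  -- Equivalence is required at all basepoints, so its failure only provides some `o'`; returning to
  -- `o` costs `2 * dist o o'`.
  refine ⟨2 * C + 2 * dist o o', fun s t => ?_⟩
  have h1 := hC s t
  unfold gromovProduct at h1
  have h2 := dist_triangle ((A ^ (s : ℤ)) o) o' o
  have h3 := dist_triangle o o' (D ((A ^ (t : ℤ)) o))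
  rw [dist_comm o' o] at h2
  rw [dist_comm o' (D _)] at h3
  linarith

end Orbits

/-! ### Coarsely straight pieces, and turns -/

section Straight

variable {X : Type*} [MetricSpace X]

/-- The piece of the sequence `x` between `a` and `b` has end points at distance at least
`c * (b - a) - C`, and passes `C`-coarsely between them. -/
def IsCoarselyStraight (c C : ℝ) (x : ℤ → X) (a b : ℤ) : Prop :=
  c * ((b : ℝ) - a) - C ≤ dist (x a) (x b) ∧
    ∀ j, a ≤ j → j ≤ b → dist (x a) (x j) + dist (x j) (x b) ≤ dist (x a) (x b) + C

theorem IsCoarselyStraight.mono {c c' C C' : ℝ} {x : ℤ → X} {a b : ℤ}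
    (h : IsCoarselyStraight c C x a b) (hab : a ≤ b) (hc : c' ≤ c) (hC : C ≤ C') :
    IsCoarselyStraight c' C' x a b := by
  have hab' : (0 : ℝ) ≤ b - a := sub_nonneg.2 (by exact_mod_cast hab)
  have h1 := mul_le_mul_of_nonneg_right hc hab'
  exact ⟨by linarith [h.1], fun j h2 h3 => by linarith [h.2 j h2 h3]⟩

theorem dist_le_mul_of_dist_succ_le {Lam : ℝ} {x : ℤ → X}
    (hx : ∀ n, dist (x n) (x (n + 1)) ≤ Lam) (n : ℤ) (k : ℕ) :
    dist (x n) (x (n + k)) ≤ Lam * k := by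
  induction k with
  | zero => simp
  | succ k ih =>
    have h1 := hx (n + k)
    have h2 := dist_triangle (x n) (x (n + k)) (x (n + k + 1))
    rw [show n + ((k + 1 : ℕ) : ℤ) = n + k + 1 by push_cast; ring]
    push_cast
    linarith

/-- A Lipschitz sequence all of whose short pieces are coarsely straight is a quasi-geodesic. -/
theorem IsDeltaHyperbolic.isQuasiGeodesic_of_isCoarselyStraight {δ c C Lam : ℝ}
    (hδ : IsDeltaHyperbolic X δ) (hLam : 0 ≤ Lam) {x : ℤ → X}
    (hx : ∀ n, dist (x n) (x (n + 1)) ≤ Lam) {p : ℕ} (hp : 0 < p)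
    (hpc : 2 * C + 4 * δ + 1 ≤ c * p)
    (hst : ∀ a b : ℤ, a ≤ b → b - a ≤ 2 * p → IsCoarselyStraight c C x a b) :
    IsQuasiGeodesic (p + Lam) (1 + Lam * p) x := by
  have hp' : (0 : ℝ) < p := by exact_mod_cast hp
  have hC : 0 ≤ C := by
    have := (hst 0 0 le_rfl (by positivity)).2 0 le_rfl le_rfl
    simp only [dist_self] at this
    linarith
  -- Every `p`-th term is kept: pieces of length `2 * p` bound the products at their midpoints by `C
  -- / 2`, and pieces of length `p` give steps of at least `c * p - C ≥ C + 4 * δ + 1`.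
  have hchain (n : ℤ) (q : ℕ) : (q : ℝ) ≤ dist (x n) (x (n + p * q)) := by
    have := hδ.le_dist_of_chain (x := fun i => x (n + p * i)) (C := C / 2) (by linarith)
      (fun i => by
        have := (hst (n + p * i) (n + p * (i + 2)) (by nlinarith) (by linarith)).2
          (n + p * (i + 1)) (by nlinarith) (by nlinarith)
        unfold gromovProduct
        rw [dist_comm (x (n + p * (i + 1))) (x (n + p * (i + 2)))] at this
        linarith)
      (fun i => by
        have := (hst (n + p * i) (n + p * (i + 1)) (by nlinarith) (by nlinarith)).1
        push_cast at this
        rw [show (n + p * (i + 1) - (n + p * i) : ℝ) = p by ring] at this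
        linarith) q 0
    simpa using this
  have key (n : ℤ) (k : ℕ) :
      1 / (p + Lam) * k - (1 + Lam * p) ≤ dist (x n) (x (n + k)) ∧
        dist (x n) (x (n + k)) ≤ (p + Lam) * k + (1 + Lam * p) := by
    have hk : (0 : ℝ) ≤ k := by positivity
    have hLp : 0 ≤ Lam * p := by positivity
    constructor
    -- Rounding `k` down to a multiple of `p` loses `1` in the count of steps and at most `Lam * p`
    -- in distance.
    · have h1 := hchain n (k / p)
      have h2 := dist_le_mul_of_dist_succ_le hx (n + p * (k / p : ℕ)) (k % p)
      have hdm := Nat.div_add_mod k p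
      have hlt := Nat.mod_lt k hp
      rw [show n + p * ((k / p : ℕ) : ℤ) + ((k % p : ℕ) : ℤ) = n + k by
        rw [add_assoc]; exact_mod_cast congrArg (fun m : ℕ => n + (m : ℤ)) hdm] at h2
      have h3 := dist_triangle_right (x n) (x (n + p * (k / p : ℕ))) (x (n + k))
      have h4 : Lam * ((k % p : ℕ) : ℝ) ≤ Lam * p :=
        mul_le_mul_of_nonneg_left (by exact_mod_cast hlt.le) hLam
      have h5 : (k : ℝ) ≤ (p + Lam) * ((k / p : ℕ) + 1) := by
        have h6 : (k : ℝ) ≤ p * ((k / p : ℕ) + 1) := by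
          exact_mod_cast (by rw [mul_add]; omega : k ≤ p * (k / p + 1))
        have h7 : 0 ≤ Lam * ((k / p : ℕ) + 1 : ℝ) := by positivity
        linarith
      have h8 : 1 / (p + Lam) * (k : ℝ) ≤ (k / p : ℕ) + 1 := by
        rw [one_div, inv_mul_le_iff₀ (by positivity)]
        exact h5
      linarith
    · have h1 := dist_le_mul_of_dist_succ_le hx n k
      have h2 : 0 ≤ (p : ℝ) * k := by positivity
      linarith
  intro n m
  rcases le_total n m with h | h
  · obtain ⟨k, rfl⟩ := Int.le.dest h
    have := key n k
    rwa [show |(n : ℝ) - (n + (k : ℤ) : ℤ)| = k by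
      push_cast; rw [sub_add_cancel_left, abs_neg, abs_of_nonneg (by positivity)]]
  · obtain ⟨k, rfl⟩ := Int.le.dest h
    have := key m k
    rw [dist_comm]
    rwa [show |((m + (k : ℤ) : ℤ) : ℝ) - m| = k by
      push_cast; rw [add_sub_cancel_left, abs_of_nonneg (by positivity)]]

/-- Powers of a hyperbolic isometry move `o` in a coarsely straight way. -/
theorem IsHyperbolicIsometry.exists_isCoarselyStraight [GromovHyperbolicSpace X] {A : X ≃ᵢ X}
    (hA : IsHyperbolicIsometry A) (o : X) : ∃ c > 0, ∃ C, ∀ (W : ℤ → X ≃ᵢ X) (a b : ℤ), a ≤ b →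
      (∀ i, a ≤ i → i ≤ b → W i = W a * A ^ (i - a)) →
        IsCoarselyStraight c C (fun i => W i o) a b := by
  obtain ⟨c, hc, K, hK⟩ := hA.exists_linear_growth o
  obtain ⟨C, hC⟩ := hA.exists_excess_le o
  refine ⟨c, hc, max K C, fun W a b hab hW => ⟨?_, fun j haj hjb => ?_⟩⟩
  · have h1 := hK (b - a)
    rw [abs_of_nonneg (by exact_mod_cast sub_nonneg.2 hab), dist_comm] at h1
    simp only [hW b hab le_rfl, IsometryEquiv.mul_apply, (W a).dist_eq]
    push_cast at h1
    linarith [le_max_left K C]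
  · have h1 := hC 0 (j - a) (b - a) (by linarith) (by linarith)
    simp only [zpow_zero, IsometryEquiv.coe_one, id] at h1
    simp only [hW b hab le_rfl, hW j haj hjb, IsometryEquiv.mul_apply, (W a).dist_eq]
    linarith [le_max_right K C]

/-- Coming in along the positive orbit of `A`, applying `D ^ (±1)`, and leaving along the positive
orbit of `A` again is coarsely straight if `D` moves the attracting point of `A`. -/
theorem IsHyperbolicIsometry.exists_isCoarselyStraight_turn [GromovHyperbolicSpace X]
    {A : X ≃ᵢ X} (hA : IsHyperbolicIsometry A) (o : X) (D : X ≃ᵢ X)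
    (hD : GromovBoundary.map D (attractingPoint A hA o) ≠ attractingPoint A hA o) :
    ∃ c > 0, ∃ C, ∀ E : X ≃ᵢ X, E = D ∨ E = D⁻¹ → ∀ (W : ℤ → X ≃ᵢ X) (a d b : ℤ),
      a ≤ d → d < b → (∀ i, a ≤ i → i ≤ d → W i = W d * A ^ (d - i)) →
      (∀ i, d < i → i ≤ b → W i = W d * E * A ^ (i - d - 1)) →
        IsCoarselyStraight c C (fun i => W i o) a b := by
  obtain ⟨c, hc, K, hK⟩ := hA.exists_linear_growth o
  obtain ⟨C₀, hC₀⟩ := hA.exists_excess_le o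
  obtain ⟨C₁, hC₁⟩ := hA.exists_excess_map_le o D hD
  set M := dist o (D o) with hM
  have hM0 : 0 ≤ M := dist_nonneg
  have hEM (E : X ≃ᵢ X) (hE : E = D ∨ E = D⁻¹) : dist o (E o) = M := by
    rcases hE with rfl | rfl
    · rfl
    · rw [← D.dist_eq, IsometryEquiv.apply_inv_self, dist_comm]
  have hE (E : X ≃ᵢ X) (hE : E = D ∨ E = D⁻¹) (s t : ℕ) :
      dist ((A ^ (s : ℤ)) o) o + dist o (E ((A ^ (t : ℤ)) o)) ≤
        dist ((A ^ (s : ℤ)) o) (E ((A ^ (t : ℤ)) o)) + (C₁ + 2 * M) := by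
    rcases hE with rfl | rfl
    · linarith [hC₁ s t]
    -- Applying `D` exchanges the two arms, so `D⁻¹` inherits the bound of `D`, up to moving the
    -- vertex between `o` and `D o` twice.
    · have h1 := hC₁ t s
      have hD' (y : X) : dist y (D⁻¹ ((A ^ (t : ℤ)) o)) = dist ((A ^ (t : ℤ)) o) (D y) := by
        rw [← D.dist_eq, IsometryEquiv.apply_inv_self, dist_comm]
      rw [hD', hD', dist_comm _ (D o)]
      have h2 : dist (D ((A ^ (s : ℤ)) o)) (D o) = dist ((A ^ (s : ℤ)) o) o := D.dist_eq _ _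
      have h3 := dist_triangle (D ((A ^ (s : ℤ)) o)) o (D o)
      have h4 := dist_triangle (D o) o ((A ^ (t : ℤ)) o)
      rw [dist_comm (D _) o] at h3
      rw [dist_comm (D o) o, dist_comm o ((A ^ (t : ℤ)) o)] at h4
      linarith
  -- The second entry is for the length: its `c` pays for the letter `E` itself. The first is for
  -- the excess at `j`: beyond the turn, the outgoing arm starts at `E o` instead of `o`, which adds
  -- `2 * M` to `C₀ + C₁ + 2 * M`.
  refine ⟨c, hc, max (C₀ + C₁ + 4 * M) (2 * K + c + C₁ + 3 * M),
    fun E hED W a d b had hdb hl hr => ⟨?_, fun j haj hjb => ?_⟩⟩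
  · obtain ⟨s, rfl⟩ := Int.le.dest had
    obtain ⟨t, rfl⟩ := Int.le.dest (Int.add_one_le_of_lt hdb)
    refine le_trans (sub_le_sub_left (le_max_right _ _) _) ?_
    have h1 := hE E hED s t
    have h2 := hK s
    have h3 := hK t
    rw [Int.cast_natCast, abs_of_nonneg (by positivity)] at h2 h3
    have h4 := dist_triangle ((A ^ (t : ℤ)) o) (E⁻¹ o) o
    rw [← E.dist_eq _ (E⁻¹ o), IsometryEquiv.apply_inv_self, ← E.dist_eq (E⁻¹ o),
      IsometryEquiv.apply_inv_self, hEM E hED, dist_comm (E _)] at h4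
    have h5 := hl a le_rfl had
    have h6 := hr _ hdb le_rfl
    rw [add_sub_cancel_left] at h5
    rw [show a + (s : ℤ) + 1 + t - (a + s) - 1 = t by ring] at h6
    simp only [h5, h6, IsometryEquiv.mul_apply, (W (a + s)).dist_eq]
    push_cast
    rw [show (a + s + 1 + t - a : ℝ) = s + t + 1 by ring]
    linarith
  · refine le_trans ?_ (add_le_add_right (le_max_left _ _) _)
    obtain ⟨s, hs⟩ := Int.eq_ofNat_of_zero_le (sub_nonneg.2 had)
    obtain ⟨t, ht⟩ := Int.eq_ofNat_of_zero_le (by omega : 0 ≤ b - d - 1)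
    have h1 := hE E hED s t
    have h5 := hl a le_rfl had
    have h6 := hr _ hdb le_rfl
    rw [hs] at h5
    rw [ht] at h6
    rcases le_or_gt j d with hjd | hjd
    · have h7 := hl j haj hjd
      have h8 := hC₀ 0 (d - j) (d - a) (by linarith) (by linarith)
      simp only [h5, h6, h7, IsometryEquiv.mul_apply, (W d).dist_eq]
      rw [hs] at h8
      simp only [zpow_zero, IsometryEquiv.coe_one, id] at h8
      have h9 := dist_triangle ((A ^ (d - j)) o) o (E ((A ^ (t : ℤ)) o))
      rw [dist_comm o, dist_comm o, dist_comm ((A ^ (d - j)) o) ((A ^ (s : ℤ)) o)] at h8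
      linarith
    · have h7 := hr j hjd hjb
      have h8 := hC₀ 0 (j - d - 1) (b - d - 1) (by linarith) (by linarith)
      simp only [h5, h6, h7, IsometryEquiv.mul_apply, (W d).dist_eq, E.dist_eq]
      rw [ht] at h8
      simp only [zpow_zero, IsometryEquiv.coe_one, id] at h8
      rw [← E.dist_eq o, ← E.dist_eq o] at h8
      have h9 := dist_triangle ((A ^ (s : ℤ)) o) o (E ((A ^ (j - d - 1)) o))
      have h10 := dist_triangle o (E o) (E ((A ^ (j - d - 1)) o))
      have h11 := dist_triangle (E o) o (E ((A ^ (t : ℤ)) o))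
      rw [dist_comm (E o) o, hEM E hED] at h11
      rw [hEM E hED] at h10
      linarith

end Straight

/-! ### Admissible words and their partial products -/

section Words

theorem Letter.not_isG {l : Letter} : ¬ l.IsG ↔ l.IsD₁ ∨ l.IsD₂ := by
  cases l <;> simp [Letter.IsG, Letter.IsD₁, Letter.IsD₂]

theorem Letter.IsD₁.not_isD₂ {l : Letter} (h : l.IsD₁) : ¬ l.IsD₂ := by
  rcases h with rfl | rfl <;> simp [Letter.IsD₂]

variable {N : ℕ} {H : ℤ → Letter}

theorem exists_next_not_isG (H : ℤ → Letter) (d : ℤ) (h : ¬ ∀ n, d < n → (H n).IsG) :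
    ∃ e, d < e ∧ ((H e).IsD₁ ∨ (H e).IsD₂) ∧ ∀ n, d < n → n < e → (H n).IsG := by
  push Not at h
  obtain ⟨e, he, hmin⟩ := Int.exists_least_of_bdd (P := fun n => d < n ∧ ¬ (H n).IsG)
    ⟨d, fun z hz => hz.1.le⟩ h
  refine ⟨e, he.1, Letter.not_isG.1 he.2, fun n hn hne => ?_⟩
  by_contra hG
  exact absurd (hmin n ⟨hn, hG⟩) (not_le.2 hne)

theorem exists_prev_not_isG (H : ℤ → Letter) (d : ℤ) (h : ¬ ∀ n, n < d → (H n).IsG) :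
    ∃ e, e < d ∧ ((H e).IsD₁ ∨ (H e).IsD₂) ∧ ∀ n, e < n → n < d → (H n).IsG := by
  push Not at h
  obtain ⟨e, he, hmax⟩ := Int.exists_greatest_of_bdd (P := fun n => n < d ∧ ¬ (H n).IsG)
    ⟨d, fun z hz => hz.1.le⟩ h
  refine ⟨e, he.1, Letter.not_isG.1 he.2, fun n hn hne => ?_⟩
  by_contra hG
  exact absurd (hmax n ⟨hne, hG⟩) (not_le.2 hn)

/-- The next letter `D_i^{±1}`, if there is one, lies more than `N` places away. With its three
companions, this makes a window of length `N` around a turn look exactly as the pattern prescribes.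
-/
theorem IsAdmissibleWord.eq_Ginv_after (hH : IsAdmissibleWord N H) {d : ℤ} (hd : (H d).IsD₁)
    {i : ℤ} (hi : d < i) (hiN : i ≤ d + N) : H i = .Ginv := by
  by_cases h : ∀ n, d < n → (H n).IsG
  · exact hH.right_tail_D₁ d hd h i hi
  · obtain ⟨e, hde, he, hG⟩ := exists_next_not_isG H d h
    obtain ⟨-, h1, h2⟩ := hH.after_D₁ d e hde hd he hG
    exact h1 i hi (by omega)

theorem IsAdmissibleWord.eq_G_after (hH : IsAdmissibleWord N H) {d : ℤ} (hd : (H d).IsD₂)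
    {i : ℤ} (hi : d < i) (hiN : i ≤ d + N) : H i = .G := by
  by_cases h : ∀ n, d < n → (H n).IsG
  · exact hH.right_tail_D₂ d hd h i hi
  · obtain ⟨e, hde, he, hG⟩ := exists_next_not_isG H d h
    obtain ⟨-, h1, h2⟩ := hH.after_D₂ d e hde hd he hG
    exact h1 i hi (by omega)

theorem IsAdmissibleWord.eq_G_before (hH : IsAdmissibleWord N H) {d : ℤ} (hd : (H d).IsD₁)
    {i : ℤ} (hi : i < d) (hiN : d ≤ i + N) : H i = .G := by
  by_cases h : ∀ n, n < d → (H n).IsG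
  · exact hH.left_tail_D₁ d hd h i hi
  · obtain ⟨e, hed, he, hG⟩ := exists_prev_not_isG H d h
    rcases he with he | he
    -- A preceding `D₁^{±1}` would force `H d` to be `D₂^{±1}`.
    · exact absurd (hH.after_D₁ e d hed he (.inl hd) hG).1 hd.not_isD₂
    · obtain ⟨-, h1, h2⟩ := hH.after_D₂ e d hed he (.inl hd) hG
      exact h1 i (by omega) hi

theorem IsAdmissibleWord.eq_Ginv_before (hH : IsAdmissibleWord N H) {d : ℤ} (hd : (H d).IsD₂)
    {i : ℤ} (hi : i < d) (hiN : d ≤ i + N) : H i = .Ginv := by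
  by_cases h : ∀ n, n < d → (H n).IsG
  · exact hH.left_tail_D₂ d hd h i hi
  · obtain ⟨e, hed, he, hG⟩ := exists_prev_not_isG H d h
    rcases he with he | he
    · obtain ⟨-, h1, h2⟩ := hH.after_D₁ e d hed he (.inr hd) hG
      exact h1 i (by omega) hi
    · exact absurd hd (hH.after_D₂ e d hed he (.inr hd) hG).1.not_isD₂

/-- In a reduced word, consecutive letters `G ^ (±1)` agree. -/
theorem IsAdmissibleWord.eq_of_isG (hH : IsAdmissibleWord N H) {a b : ℤ}
    (hG : ∀ i, a ≤ i → i < b → (H i).IsG) {i : ℤ} (hai : a ≤ i) (hib : i < b) : H i = H a := by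
  induction i, hai using Int.leInduction with
  | base => rfl
  | succ i hai ih =>
    have h1 := hH.reduced i
    rw [← ih (by omega)]
    rcases hG i hai (by omega) with h | h <;> rcases hG (i + 1) (by omega) hib with h' | h' <;>
      simp [h, h', Letter.inv] at h1 ⊢

variable {X : Type*} [MetricSpace X] (G D₁ D₂ : X ≃ᵢ X)

theorem Letter.eval_inv (l : Letter) : l.inv.eval G D₁ D₂ = (l.eval G D₁ D₂)⁻¹ := by
  cases l <;> simp [Letter.inv, Letter.eval]

/-- One recursion covers both signs of `n`: for negative `n`, multiplying by `H n` cancels the last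
factor of the word. -/
theorem partialWord_succ (H : ℤ → Letter) (n : ℤ) :
    partialWord G D₁ D₂ H (n + 1) = partialWord G D₁ D₂ H n * (H n).eval G D₁ D₂ := by
  rcases n with n | n
  · change ((List.range (n + 1)).map _).prod = ((List.range n).map _).prod * _
    rw [List.range_succ, List.map_append, List.prod_append]
    simp
  · have h : partialWord G D₁ D₂ H (Int.negSucc n + 1) =
        ((List.range n).map fun i : ℕ => (H (-(i : ℤ) - 1)).inv.eval G D₁ D₂).prod := by
      cases n <;> rfl
    have e : (-(n : ℤ) - 1) = Int.negSucc n := by rw [Int.negSucc_eq]; ring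
    rw [h]
    change _ = ((List.range (n + 1)).map _).prod * _
    rw [List.range_succ, List.map_append, List.prod_append]
    simp [Letter.eval_inv, e]

theorem partialWord_eq_mul_zpow {a b : ℤ} (hab : a ≤ b) {l : Letter}
    (hl : ∀ i, a ≤ i → i < b → H i = l) :
    partialWord G D₁ D₂ H b = partialWord G D₁ D₂ H a * (l.eval G D₁ D₂) ^ (b - a) := by
  induction b, hab using Int.leInduction with
  | base => simp
  | succ b hab ih =>
    rw [partialWord_succ, ih fun i h1 h2 => hl i h1 (by omega), hl b hab (by omega), mul_assoc,
      ← zpow_add_one]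
    congr 2
    ring

/-- The shape of an admissible word around a letter `D`, in terms of partial words. -/
theorem partialWord_turn {a d b : ℤ} {l l' : Letter} {A : X ≃ᵢ X}
    (hl : l.eval G D₁ D₂ = A⁻¹) (hl' : l'.eval G D₁ D₂ = A)
    (hbefore : ∀ i, a ≤ i → i < d → H i = l) (hafter : ∀ i, d < i → i < b → H i = l') :
    (∀ i, a ≤ i → i ≤ d →
      partialWord G D₁ D₂ H i = partialWord G D₁ D₂ H d * A ^ (d - i)) ∧
    (∀ i, d < i → i ≤ b → partialWord G D₁ D₂ H i =
      partialWord G D₁ D₂ H d * (H d).eval G D₁ D₂ * A ^ (i - d - 1)) := by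
  refine ⟨fun i hai hid => ?_, fun i hdi hib => ?_⟩
  -- Read backwards from `d`, the letters `A⁻¹` before the turn become positive powers of `A`.
  · rw [partialWord_eq_mul_zpow G D₁ D₂ hid fun j h1 h2 => hbefore j (hai.trans h1) h2, hl,
      inv_zpow, inv_mul_cancel_right]
  · rw [partialWord_eq_mul_zpow G D₁ D₂ (Int.add_one_le_of_lt hdi)
      fun j h1 h2 => hafter j (by omega) (by omega), hl', partialWord_succ, sub_sub]

theorem exists_dist_partialWord_succ_le (o : X) : ∃ Lam : ℝ, 0 ≤ Lam ∧ ∀ (H : ℤ → Letter) (n : ℤ),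
    dist (partialWord G D₁ D₂ H n o) (partialWord G D₁ D₂ H (n + 1) o) ≤ Lam := by
  have hinv (A : X ≃ᵢ X) : dist o (A⁻¹ o) = dist o (A o) := by
    rw [← A.dist_eq, IsometryEquiv.apply_inv_self, dist_comm]
  have h1 : 0 ≤ dist o (G o) := dist_nonneg
  have h2 : 0 ≤ dist o (D₁ o) := dist_nonneg
  have h3 : 0 ≤ dist o (D₂ o) := dist_nonneg
  refine ⟨dist o (G o) + dist o (D₁ o) + dist o (D₂ o), by positivity, fun H n => ?_⟩
  rw [partialWord_succ, IsometryEquiv.mul_apply, IsometryEquiv.dist_eq]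
  cases H n <;> simp only [Letter.eval, hinv] <;> linarith

/-- Short pieces of admissible words are coarsely straight, with uniform constants. -/
theorem exists_isCoarselyStraight_partialWord [GromovHyperbolicSpace X] (o : X)
    (hG : IsHyperbolicIsometry G)
    (hD₁ : GromovBoundary.map D₁ (repellingPoint G hG o) ≠ repellingPoint G hG o)
    (hD₂ : GromovBoundary.map D₂ (attractingPoint G hG o) ≠ attractingPoint G hG o) :
    ∃ c > 0, ∃ C, ∀ (N : ℕ) (H : ℤ → Letter), IsAdmissibleWord N H → ∀ a b : ℤ, a ≤ b →
      b - a ≤ N → IsCoarselyStraight c C (fun n => partialWord G D₁ D₂ H n o) a b := by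
  obtain ⟨c₁, hc₁, C₁, h₁⟩ := hG.exists_isCoarselyStraight o
  obtain ⟨c₂, hc₂, C₂, h₂⟩ := hG.inv.exists_isCoarselyStraight o
  -- The repelling point of `G` is by definition the attracting point of `G⁻¹`, so `hD₁` is the turn
  -- condition for `A = G⁻¹`.
  obtain ⟨c₃, hc₃, C₃, h₃⟩ := hG.inv.exists_isCoarselyStraight_turn o D₁ hD₁
  obtain ⟨c₄, hc₄, C₄, h₄⟩ := hG.exists_isCoarselyStraight_turn o D₂ hD₂
  refine ⟨min (min c₁ c₂) (min c₃ c₄), by positivity, max (max C₁ C₂) (max C₃ C₄),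
    fun N H hH a b hab hN => ?_⟩
  by_cases hall : ∀ i, a ≤ i → i < b → (H i).IsG
  -- An empty piece has no first letter to fix the sign of the power.
  · rcases hab.eq_or_lt with rfl | hlt
    · exact (h₁ (partialWord G D₁ D₂ H) a a le_rfl
        (fun i h1 h2 => by simp [le_antisymm h2 h1])).mono le_rfl (by simp) (by simp)
    have hW i (h1 : a ≤ i) (h2 : i ≤ b) := partialWord_eq_mul_zpow G D₁ D₂ h1
      fun j h3 h4 => hH.eq_of_isG hall h3 (h4.trans_le h2)
    rcases hall a le_rfl hlt with h | h
    · rw [h] at hW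
      exact (h₁ _ a b hab hW).mono hab (by simp) (by simp)
    · rw [h] at hW
      exact (h₂ _ a b hab hW).mono hab (by simp) (by simp)
  · push Not at hall
    obtain ⟨d, had, hdb, hd⟩ := hall
    rcases Letter.not_isG.1 hd with hd | hd
    · obtain ⟨hl, hr⟩ := partialWord_turn (a := a) (d := d) (b := b) (l := .G) (l' := .Ginv)
        (A := G⁻¹) G D₁ D₂ (inv_inv G).symm rfl
        (fun i h1 h2 => hH.eq_G_before hd h2 (by omega))
        (fun i h1 h2 => hH.eq_Ginv_after hd h1 (by omega))
      refine (h₃ ((H d).eval G D₁ D₂) ?_ _ a d b had hdb hl hr).mono hab (by simp) (by simp)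
      rcases hd with h | h <;> simp [h, Letter.eval]
    · obtain ⟨hl, hr⟩ := partialWord_turn (a := a) (d := d) (b := b) (l := .Ginv) (l' := .G)
        (A := G) G D₁ D₂ rfl rfl
        (fun i h1 h2 => hH.eq_Ginv_before hd h2 (by omega))
        (fun i h1 h2 => hH.eq_G_after hd h1 (by omega))
      refine (h₄ ((H d).eval G D₁ D₂) ?_ _ a d b had hdb hl hr).mono hab (by simp) (by simp)
      rcases hd with h | h <;> simp [h, Letter.eval]

end Words

theorem mainTheorem4 {X : Type*} [MetricSpace X] [GromovHyperbolicSpace X]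
    (hgeod : IsGeodesicSpace X) (hvis : IsVisibilitySpace X) (o : X)
    (G D₁ D₂ : X ≃ᵢ X) (hG : IsHyperbolicIsometry G)
    (hD₁ : GromovBoundary.map D₁ (repellingPoint G hG o) ≠ repellingPoint G hG o)
    (hD₂ : GromovBoundary.map D₂ (attractingPoint G hG o) ≠ attractingPoint G hG o) :
    ∃ lam > (0 : ℝ), ∃ k ≥ (0 : ℝ), ∃ N : ℕ, 1 ≤ N ∧
      ∀ H : ℤ → Letter, IsAdmissibleWord N H →
        IsQuasiGeodesic lam k (fun n : ℤ => partialWord G D₁ D₂ H n o) := by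
  obtain ⟨δ, hδ⟩ := GromovHyperbolicSpace.exists_delta (X := X)
  obtain ⟨c, hc, C, hst⟩ := exists_isCoarselyStraight_partialWord G D₁ D₂ o hG hD₁ hD₂
  obtain ⟨Lam, hLam, hlip⟩ := exists_dist_partialWord_succ_le G D₁ D₂ o
  -- Since `c` and `C` serve all `N`, `p` may be chosen after them, and then `N = 2 * p` makes every
  -- piece of length at most `2 * p` straight.
  obtain ⟨p, hp⟩ := exists_nat_gt (max 0 ((2 * C + 4 * δ + 1) / c))
  have hp0 : (0 : ℝ) < p := lt_of_le_of_lt (le_max_left _ _) hp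
  have hpc := lt_of_le_of_lt (le_max_right _ _) hp
  rw [div_lt_iff₀' hc] at hpc
  have hp1 : 0 < p := by exact_mod_cast hp0
  refine ⟨p + Lam, by positivity, 1 + Lam * p, by positivity, 2 * p, by omega, fun H hH => ?_⟩
  exact hδ.isQuasiGeodesic_of_isCoarselyStraight hLam (hlip H) hp1 hpc.le
    fun a b hab hN => hst (2 * p) H hH a b hab (by exact_mod_cast hN)
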